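/- Let $M\in\mathbb Z^{m\times n}$, $b\in\mathbb Z^m$ and $Q:=\{x\in\mathbb R^n : Mx\le b\}$. For $w\in\mathbb R^n$ consider the dual pair of linear programs $$(P_w)\ \ \max\{w^\top x : Mx\le b\},\qquad (D_w)\ \ \min\{b^\top y : M^\top y=w,\ y\ge \mathbf 0\},$$ and call $w$ admissible if $(P_w)$ has an optimal solution (equivalently, by strong duality, if both programs have one). For $\mathbb L\subseteq\mathbb R$, the system $Mx\le b$ is totally dual in $\mathbb L$ if for every admissible $w\in\mathbb L^n$ the program $(D_w)$ has an optimal solution in $\mathbb L^m$. The set $\mathbb L$ is heavy if it is dense in $\mathbb R$, contains all integers, and is a subgroup of $(\mathbb R,+)$. For a set $\mathcal S$ of primes, $\mathbb L(\mathcal S)$ is the set of rationals $r/s$ with $r\in\mathbb Z$ and $s$ a product of nonnegative integer powers of primes in $\mathcal S$; for an integer $p\ge 2$, $\mathbb L_{[p]}:=\mathbb L(\{q : q\text{ prime},\ q\le p\})$. The system is totally dual dyadic if it is totally dual in $\mathbb L(\{2\})$. A polyhedron is integral if each of its inclusion-minimal nonempty faces contains a point of $\mathbb Z^n$ (so $\emptyset$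 is integral). For an integer $p\ge 1$, the system $Mx\le b$ is $\frac1p$-resilient if $Q$ is integral and for every $i\in\{1,\dots,m\}$ there is $s\in\{1,\dots,p\}$ such that $Q\cap\{x : \mathrm{row}_i(M)x\le b_i-s\}$ is integral; it is resilient if it is $1$-resilient, and half-resilient if it is $\frac12$-resilient. Suppose that $Q$ is full-dimensional, that is, its affine hull is $\mathbb R^n$. Then: (a) If $Mx\le b$ is resilient, then it is totally dual in $\mathbb L$ for every heavy set $\mathbb L$. (b) If $Mx\le b$ is half-resilient, then it is totally dual dyadic. (c) If $Mx\le b$ is $\frac1p$-resilient for an integer $p\ge 2$, then it is totally dual in $\mathbb L_{[p]}$. -/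

import Mathlib

open scoped Matrix

namespace TotalDuality

variable {m n : ℕ}

/-- An integer matrix, viewed as a real matrix. -/
def toReal (M : Matrix (Fin m) (Fin n) ℤ) : Matrix (Fin m) (Fin n) ℝ :=
  M.map (fun z : ℤ => (z : ℝ))

/-- The polyhedron `{x ∈ ℝⁿ : M x ≤ b}`. -/
def polyhedron (M : Matrix (Fin m) (Fin n) ℤ) (b : Fin m → ℤ) : Set (Fin n → ℝ) :=
  {x | ∀ i, (toReal M *ᵥ x) i ≤ (b i : ℝ)}

/-- A set in `ℝⁿ` is full-dimensional if its affine hull is all of `ℝⁿ`. -/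
def IsFullDimensional (Q : Set (Fin n → ℝ)) : Prop :=
  affineSpan ℝ Q = ⊤

/-- The points of `ℤⁿ` in `ℝⁿ`. -/
def integerPoints (n : ℕ) : Set (Fin n → ℝ) :=
  {x | ∀ j, ∃ z : ℤ, x j = (z : ℝ)}

/-- The nonempty faces of a polyhedron `Q`: the sets of maximisers over `Q` of linear functionals
(the zero functional gives `Q` itself). -/
def IsNonemptyFace (Q F : Set (Fin n → ℝ)) : Prop :=
  F.Nonempty ∧ IsExposed ℝ Q F

/-- A polyhedron is integral if each of its inclusion-minimal nonempty faces contains an integer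
point. In particular the empty polyhedron is integral. -/
def IsIntegralPolyhedron (Q : Set (Fin n → ℝ)) : Prop :=
  ∀ F : Set (Fin n → ℝ), Minimal (IsNonemptyFace Q) F → (F ∩ integerPoints n).Nonempty

/-- `Q ∩ {x : rowᵢ(M) x ≤ bᵢ - s}`, where `Q = {x : M x ≤ b}`. -/
def shiftedPolyhedron (M : Matrix (Fin m) (Fin n) ℤ) (b : Fin m → ℤ) (i : Fin m) (s : ℕ) :
    Set (Fin n → ℝ) :=
  polyhedron M b ∩ {x | (toReal M *ᵥ x) i ≤ (b i : ℝ) - (s : ℝ)}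

/-- The system `M x ≤ b` is resilient. -/
def IsResilient (M : Matrix (Fin m) (Fin n) ℤ) (b : Fin m → ℤ) : Prop :=
  IsIntegralPolyhedron (polyhedron M b) ∧
    ∀ i, IsIntegralPolyhedron (shiftedPolyhedron M b i 1)

/-- The system `M x ≤ b` is half-resilient. -/
def IsHalfResilient (M : Matrix (Fin m) (Fin n) ℤ) (b : Fin m → ℤ) : Prop :=
  IsIntegralPolyhedron (polyhedron M b) ∧
    ∀ i, IsIntegralPolyhedron (shiftedPolyhedron M b i 1) ∨
      IsIntegralPolyhedron (shiftedPolyhedron M b i 2)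

/-- The system `M x ≤ b` is `1/p`-resilient. -/
def IsOneDivResilient (p : ℕ) (M : Matrix (Fin m) (Fin n) ℤ) (b : Fin m → ℤ) : Prop :=
  IsIntegralPolyhedron (polyhedron M b) ∧
    ∀ i, ∃ s : ℕ, 1 ≤ s ∧ s ≤ p ∧ IsIntegralPolyhedron (shiftedPolyhedron M b i s)

/-- `x` is an optimal solution of the primal `max {wᵀx : M x ≤ b}`. -/
def IsPrimalOptimal (M : Matrix (Fin m) (Fin n) ℤ) (b : Fin m → ℤ) (w x : Fin n → ℝ) : Prop :=
  x ∈ polyhedron M b ∧ ∀ x' ∈ polyhedron M b, w ⬝ᵥ x' ≤ w ⬝ᵥ x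

/-- The feasible region of the dual: `{y ∈ ℝᵐ : Mᵀy = w, y ≥ 0}`. -/
def dualFeasible (M : Matrix (Fin m) (Fin n) ℤ) (w : Fin n → ℝ) : Set (Fin m → ℝ) :=
  {y | (toReal M)ᵀ *ᵥ y = w ∧ ∀ i, 0 ≤ y i}

/-- `y` is an optimal solution of the dual `min {bᵀy : Mᵀy = w, y ≥ 0}`. -/
def IsDualOptimal (M : Matrix (Fin m) (Fin n) ℤ) (b : Fin m → ℤ) (w : Fin n → ℝ)
    (y : Fin m → ℝ) : Prop :=
  y ∈ dualFeasible M w ∧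
    ∀ y' ∈ dualFeasible M w, (fun i => (b i : ℝ)) ⬝ᵥ y ≤ (fun i => (b i : ℝ)) ⬝ᵥ y'

/-- `w` is admissible if the primal has an optimal solution; by strong duality this holds if and
only if the primal and the dual both have one. -/
def IsAdmissible (M : Matrix (Fin m) (Fin n) ℤ) (b : Fin m → ℤ) (w : Fin n → ℝ) : Prop :=
  ∃ x, IsPrimalOptimal M b w x

/-- The system `M x ≤ b` is totally dual in `L`. -/
def IsTotallyDualIn (L : Set ℝ) (M : Matrix (Fin m) (Fin n) ℤ) (b : Fin m → ℤ) : Prop :=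
  ∀ w : Fin n → ℝ, (∀ j, w j ∈ L) → IsAdmissible M b w →
    ∃ y : Fin m → ℝ, IsDualOptimal M b w y ∧ ∀ i, y i ∈ L

/-- A set of reals is heavy if it is dense, contains the integers, and is an additive subgroup
of `ℝ`. -/
structure IsHeavy (L : Set ℝ) : Prop where
  dense : Dense L
  int_mem : ∀ z : ℤ, (z : ℝ) ∈ L
  isAddSubgroup : ∃ H : AddSubgroup ℝ, (H : Set ℝ) = L

/-- For a set `S` of primes, the rationals `r / s` with `r` an integer and `s` a product of powers
of elements of `S`. -/
def rationalsOver (S : Set ℕ) : Set ℝ :=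
  {x | ∃ r : ℤ, ∃ s ∈ Submonoid.closure S, x = (r : ℝ) / (s : ℝ)}

/-- The system `M x ≤ b` is totally dual dyadic. -/
def IsTotallyDualDyadic (M : Matrix (Fin m) (Fin n) ℤ) (b : Fin m → ℤ) : Prop :=
  IsTotallyDualIn (rationalsOver {2}) M b

/-- The rationals whose denominator is a product of powers of primes that are at most `p`. -/
def rationalsUpTo (p : ℕ) : Set ℝ :=
  rationalsOver {q | q.Prime ∧ q ≤ p}

end TotalDuality

namespace TotalDuality

variable {m n : ℕ}

/-! Fix an admissible `w` with entries in `L`. Among the optimal primal points take `x₀` with the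
smallest tight set `I`. Strict complementarity gives a real dual solution `y` that is positive
exactly on `I`. By complementary slackness, any nonnegative solution of `Mᵀy = w` supported on `I`
is optimal, so it suffices to move `y` into `L` without leaving this support or losing positivity.

This takes two ingredients. Arithmetic (`exists_row_combination`): ignoring signs, some `z` with
entries in `L`, supported on `I`, has `Mᵀz = w`. Density (`mem_closure_of_dotProduct_eq_zero`): `y -
z` solves a homogeneous integer system, whose solutions over a dense subgroup are dense among the
real ones. A solution `u` over `L` close to `y - z` makes `z + u` the required dual optimum.

The arithmetic part peels off one row at a time by passing to covering faces. Resilience supplies an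
integer vector that annihilates the rows tight on the larger face and takes the value `-t`, with `1
≤ t ≤ p`, on one further row `i` (`exists_int_step`). Pairing with it reads off the coefficient of
row `i`, at the cost of a division by `t`. Full-dimensionality ends the recursion: a row tight on
all of the polyhedron is zero. For `p = 1` nothing is divided, so every dense subgroup works. -/

/-- The `i`-th row of `M` as a linear functional. -/
def rowForm (M : Matrix (Fin m) (Fin n) ℤ) (i : Fin m) : (Fin n → ℝ) →ₗ[ℝ] ℝ :=
  LinearMap.proj i ∘ₗ (toReal M).mulVecLin

open Classical in
/-- The indices of the constraints that hold with equality at `x`. -/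
noncomputable def tightSet (M : Matrix (Fin m) (Fin n) ℤ) (b : Fin m → ℤ) (x : Fin n → ℝ) :
    Finset (Fin m) :=
  Finset.univ.filter fun i => rowForm M i x = b i

variable {M : Matrix (Fin m) (Fin n) ℤ} {b : Fin m → ℤ}

theorem mem_tightSet {x : Fin n → ℝ} {i : Fin m} :
    i ∈ tightSet M b x ↔ rowForm M i x = b i := by
  simp [tightSet]

theorem rowForm_intCast (i : Fin m) (z : Fin n → ℤ) :
    rowForm M i (fun j => (z j : ℝ)) = ((M *ᵥ z) i : ℤ) := by
  simp [rowForm, toReal, Matrix.mulVec, dotProduct]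

theorem dotProduct_transpose_mulVec (y : Fin m → ℝ) (e : Fin n → ℝ) :
    ((toReal M)ᵀ *ᵥ y) ⬝ᵥ e = ∑ i, y i * rowForm M i e := by
  rw [Matrix.mulVec_transpose, ← Matrix.dotProduct_mulVec]
  rfl

/-! ### Farkas' lemma and the ratio test. -/

section LinearInequalities

/-- Farkas' lemma for finitely many linear functionals. -/
theorem exists_nonneg_combination {ι E : Type*} [AddCommGroup E] [Module ℝ E]
    (s : Finset ι) (a : ι → E →ₗ[ℝ] ℝ) (f : E →ₗ[ℝ] ℝ)
    (h : ∀ x, (∀ i ∈ s, a i x ≤ 0) → f x ≤ 0) :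
    ∃ c : ι → ℝ, (∀ i, 0 ≤ c i) ∧ ∀ x, f x = ∑ i ∈ s, c i * a i x := by
  classical
  induction s using Finset.induction_on generalizing a f with
  | empty =>
    refine ⟨0, by simp, fun x => ?_⟩
    have h₁ := h x (by simp)
    have h₂ := h (-x) (by simp)
    rw [map_neg] at h₂
    simp only [Finset.sum_empty]
    linarith
  | insert j s hj ih =>
    by_cases hs : ∀ x, (∀ i ∈ s, a i x ≤ 0) → f x ≤ 0
    · obtain ⟨c, hc, hf⟩ := ih a f hs
      refine ⟨Function.update c j 0, fun i => ?_, fun x => ?_⟩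
      · by_cases hi : i = j
        · subst hi; simp
        · simpa [hi] using hc i
      · rw [Finset.sum_insert hj, Function.update_self, zero_mul, zero_add, hf]
        refine Finset.sum_congr rfl fun i hi => ?_
        rw [Function.update_of_ne (ne_of_mem_of_not_mem hi hj)]
    · push Not at hs
      obtain ⟨x₀, hx₀, hfx₀⟩ := hs
      have hjx : 0 < a j x₀ := by
        by_contra hcon
        refine absurd (h x₀ fun i hi => ?_) (not_le.2 hfx₀)
        rcases Finset.mem_insert.1 hi with rfl | hi
        · exact not_lt.1 hcon
        · exact hx₀ i hi
      -- `P` is the projection onto `ker (a j)` along `x₀`. The signs of `f` and of the other `a i`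
      -- at `x₀` make the coefficient of `a j` nonnegative.
      let P : E →ₗ[ℝ] E := LinearMap.id - (a j).smulRight ((a j x₀)⁻¹ • x₀)
      have hP : ∀ x, P x = x - (a j x / a j x₀) • x₀ := fun x => by
        simp [P, smul_smul, div_eq_mul_inv]
      obtain ⟨c, hc, hf⟩ := ih (fun i => a i ∘ₗ P) (f ∘ₗ P) fun x hx => by
        refine h (P x) fun i hi => ?_
        rcases Finset.mem_insert.1 hi with rfl | hi
        · rw [hP, map_sub, map_smul, smul_eq_mul, div_mul_cancel₀ _ hjx.ne', sub_self]
        · exact hx i hi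
      have hc₀ : ∑ i ∈ s, c i * a i x₀ ≤ 0 :=
        Finset.sum_nonpos fun i hi => mul_nonpos_of_nonneg_of_nonpos (hc i) (hx₀ i hi)
      refine ⟨Function.update c j ((f x₀ - ∑ i ∈ s, c i * a i x₀) / a j x₀),
        fun i => ?_, fun x => ?_⟩
      · by_cases hi : i = j
        · subst hi
          rw [Function.update_self]
          exact div_nonneg (by linarith) hjx.le
        · simpa [hi] using hc i
      · have hfx := hf x
        simp only [LinearMap.comp_apply, hP, map_sub, map_smul, smul_eq_mul, mul_sub,
          Finset.sum_sub_distrib] at hfx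
        have hsum : ∑ i ∈ s, c i * (a j x / a j x₀ * a i x₀) =
            a j x / a j x₀ * ∑ i ∈ s, c i * a i x₀ := by
          rw [Finset.mul_sum]
          exact Finset.sum_congr rfl fun i _ => by ring
        rw [hsum] at hfx
        rw [Finset.sum_insert hj, Function.update_self]
        have hsum' : ∑ i ∈ s, Function.update c j
            ((f x₀ - ∑ i ∈ s, c i * a i x₀) / a j x₀) i * a i x = ∑ i ∈ s, c i * a i x :=
          Finset.sum_congr rfl fun i hi => by
            rw [Function.update_of_ne (ne_of_mem_of_not_mem hi hj)]
        rw [hsum']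
        have : (f x₀ - ∑ i ∈ s, c i * a i x₀) / a j x₀ * a j x =
            a j x / a j x₀ * f x₀ - a j x / a j x₀ * ∑ i ∈ s, c i * a i x₀ := by
          ring
        linarith

/-- The ratio test: the largest step that keeps finitely many linear constraints satisfied. -/
theorem exists_max_step {ι : Type*} (s : Finset ι) (α β : ι → ℝ)
    (hα : ∀ i ∈ s, 0 ≤ α i) (hβ : ∃ i ∈ s, 0 < β i) :
    ∃ t, 0 ≤ t ∧ (∀ i ∈ s, t * β i ≤ α i) ∧ ∃ i ∈ s, 0 < β i ∧ t * β i = α i := by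
  classical
  obtain ⟨i₀, hi₀, hβi₀⟩ := hβ
  obtain ⟨k, hk, hmin⟩ := Finset.exists_min_image (s.filter fun i => 0 < β i)
    (fun i => α i / β i) ⟨i₀, by simp [hi₀, hβi₀]⟩
  rw [Finset.mem_filter] at hk
  have ht : 0 ≤ α k / β k := div_nonneg (hα k hk.1) hk.2.le
  refine ⟨α k / β k, ht, fun i hi => ?_, k, hk.1, hk.2, div_mul_cancel₀ _ hk.2.ne'⟩
  by_cases hβi : 0 < β i
  · exact (le_div_iff₀ hβi).1 (hmin i (by simp [hi, hβi]))
  · exact (mul_nonpos_of_nonneg_of_nonpos ht (not_lt.1 hβi)).trans (hα i hi)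

end LinearInequalities

/-! ### Faces described by tight constraints, and integer points on them. -/

section Faces

-- For small positive steps the slack constraints stay slack, so only the tight rows matter.
open Topology in
theorem exists_pos_step {x e : Fin n → ℝ} (hx : x ∈ polyhedron M b)
    (he : ∀ i ∈ tightSet M b x, rowForm M i e ≤ 0) :
    ∃ ε : ℝ, 0 < ε ∧ x + ε • e ∈ polyhedron M b ∧
      ∀ i, i ∈ tightSet M b (x + ε • e) ↔ i ∈ tightSet M b x ∧ rowForm M i e = 0 := by
  have key : ∀ᶠ ε in 𝓝[>] (0 : ℝ), ∀ i,
      rowForm M i x + ε * rowForm M i e ≤ b i ∧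
        (rowForm M i x + ε * rowForm M i e = b i ↔
          rowForm M i x = b i ∧ rowForm M i e = 0) := by
    rw [Filter.eventually_all]
    intro i
    by_cases hi : rowForm M i x = b i
    · filter_upwards [self_mem_nhdsWithin] with ε hε
      have hε : 0 < ε := hε
      have hie := he i (mem_tightSet.2 hi)
      have hle : ε * rowForm M i e ≤ 0 := mul_nonpos_of_nonneg_of_nonpos hε.le hie
      refine ⟨by linarith, fun h => ⟨hi, ?_⟩, fun h => by rw [h.1, h.2]; simp⟩
      have : ε * rowForm M i e = 0 := by linarith
      exact (mul_eq_zero.1 this).resolve_left hε.ne'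
    · have hlt : rowForm M i x < b i := lt_of_le_of_ne (hx i) hi
      have hcont : Filter.Tendsto (fun ε : ℝ => rowForm M i x + ε * rowForm M i e) (𝓝 0)
          (𝓝 (rowForm M i x + 0 * rowForm M i e)) :=
        (by fun_prop : Continuous fun ε : ℝ =>
          rowForm M i x + ε * rowForm M i e).tendsto 0
      have hev := hcont.eventually_lt_const (u := (b i : ℝ)) (by simpa using hlt)
      filter_upwards [nhdsWithin_le_nhds hev] with ε hε
      exact ⟨hε.le, fun h => absurd h hε.ne, fun h => absurd h.1 hi⟩
  obtain ⟨ε, hε, hpos⟩ := (key.and self_mem_nhdsWithin).exists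
  refine ⟨ε, hpos, fun i => ?_, fun i => ?_⟩
  · change rowForm M i _ ≤ _
    rw [map_add, map_smul]
    exact (hε i).1
  · rw [mem_tightSet, mem_tightSet, map_add, map_smul]
    exact (hε i).2

theorem convex_polyhedron : Convex ℝ (polyhedron M b) := by
  intro x hx y hy s t hs ht hst i
  change rowForm M i _ ≤ _
  have hx : rowForm M i x ≤ b i := hx i
  have hy : rowForm M i y ≤ b i := hy i
  rw [map_add, map_smul, map_smul, smul_eq_mul, smul_eq_mul]
  calc _ ≤ s * b i + t * b i := by gcongr
    _ = b i := by rw [← add_mul, hst, one_mul]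

theorem tightSet_midpoint {x y : Fin n → ℝ} (hx : x ∈ polyhedron M b)
    (hy : y ∈ polyhedron M b) {i : Fin m} :
    i ∈ tightSet M b ((1 / 2 : ℝ) • x + (1 / 2 : ℝ) • y) ↔
      i ∈ tightSet M b x ∧ i ∈ tightSet M b y := by
  have hx : rowForm M i x ≤ b i := hx i
  have hy : rowForm M i y ≤ b i := hy i
  simp only [mem_tightSet, map_add, map_smul, smul_eq_mul]
  refine ⟨fun h => ⟨by linarith, by linarith⟩, fun h => by rw [h.1, h.2]; ring⟩

theorem midpoint_mem_polyhedron {x y : Fin n → ℝ} (hx : x ∈ polyhedron M b)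
    (hy : y ∈ polyhedron M b) :
    (1 / 2 : ℝ) • x + (1 / 2 : ℝ) • y ∈ polyhedron M b :=
  convex_polyhedron hx hy (by norm_num) (by norm_num) (by norm_num)

/-- A point of `F` with the fewest tight constraints acts as a relative interior point: its tight
set cuts out `F`, because one can step slightly past it away from any `y` satisfying the same
equalities. -/
theorem exists_face_eq {F : Set (Fin n → ℝ)} (hF : IsNonemptyFace (polyhedron M b) F) :
    ∃ I : Finset (Fin m), F = {y | y ∈ polyhedron M b ∧ I ⊆ tightSet M b y} := by
  obtain ⟨l, hl⟩ := hF.2 hF.1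
  obtain ⟨x, hx, hmin⟩ :=
    exists_minimalFor_of_wellFoundedLT (· ∈ F) (tightSet M b) hF.1
  have hxF := hx
  rw [hl] at hx
  refine ⟨tightSet M b x, Set.Subset.antisymm (fun y hy => ?_) fun y hy => ?_⟩
  · have hy' := hy
    rw [hl] at hy'
    have hmid : (1 / 2 : ℝ) • x + (1 / 2 : ℝ) • y ∈ F := by
      rw [hl]
      refine ⟨midpoint_mem_polyhedron hx.1 hy'.1, fun z hz => ?_⟩
      have h₁ := hx.2 z hz
      have h₂ := hy'.2 z hz
      simp only [map_add, map_smul, smul_eq_mul]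
      linarith
    have hsub := hmin hmid fun i hi => ((tightSet_midpoint hx.1 hy'.1).1 hi).1
    exact ⟨hy'.1, fun i hi => ((tightSet_midpoint hx.1 hy'.1).1 (hsub hi)).2⟩
  · rw [hl]
    obtain ⟨ε, hε, hmem, -⟩ := exists_pos_step (e := x - y) hx.1 fun i hi => by
      rw [map_sub, mem_tightSet.1 hi, mem_tightSet.1 (hy.2 hi), sub_self]
    refine ⟨hy.1, fun z hz => (hx.2 z hz).trans ?_⟩
    have h := hx.2 _ hmem
    rw [map_add, map_smul, map_sub, smul_eq_mul] at h
    have : ε * (l x - l y) ≤ 0 := by linarith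
    nlinarith

theorem exists_minimal_face {F : Set (Fin n → ℝ)} (hF : IsNonemptyFace (polyhedron M b) F) :
    ∃ G ⊆ F, Minimal (IsNonemptyFace (polyhedron M b)) G := by
  have hfin : {G | IsNonemptyFace (polyhedron M b) G}.Finite := by
    refine (Set.finite_range fun I : Finset (Fin m) =>
      {y | y ∈ polyhedron M b ∧ I ⊆ tightSet M b y}).subset fun G hG => ?_
    obtain ⟨I, hI⟩ := exists_face_eq hG
    exact ⟨I, hI.symm⟩
  exact hfin.exists_le_minimal hF

theorem isNonemptyFace_tight {x : Fin n → ℝ} (hx : x ∈ polyhedron M b) :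
    IsNonemptyFace (polyhedron M b)
      {y | y ∈ polyhedron M b ∧ tightSet M b x ⊆ tightSet M b y} := by
  refine ⟨⟨x, hx, subset_rfl⟩, fun _ => ⟨LinearMap.toContinuousLinearMap
    (∑ i ∈ tightSet M b x, rowForm M i), ?_⟩⟩
  ext y
  simp only [Set.mem_ofPred_eq, LinearMap.coe_toContinuousLinearMap', LinearMap.sum_apply]
  refine and_congr_right fun hy => ⟨fun h z hz => Finset.sum_le_sum fun i hi => ?_, fun h => ?_⟩
  · rw [mem_tightSet.1 (h hi)]
    exact hz i
  · have hle : ∀ i ∈ tightSet M b x, rowForm M i y ≤ rowForm M i x := fun i hi => by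
      rw [mem_tightSet.1 hi]
      exact hy i
    have heq := (Finset.sum_eq_sum_iff_of_le hle).1
      (le_antisymm (Finset.sum_le_sum hle) (h x hx))
    intro i hi
    rw [mem_tightSet, heq i hi, mem_tightSet.1 hi]

/-- The usable form of integrality: the face cut out by the constraints tight at `x` contains a
minimal face, hence an integer point. -/
theorem IsIntegralPolyhedron.exists_int_tight (h : IsIntegralPolyhedron (polyhedron M b))
    {x : Fin n → ℝ} (hx : x ∈ polyhedron M b) :
    ∃ z : Fin n → ℤ, (fun j => (z j : ℝ)) ∈ polyhedron M b ∧
      tightSet M b x ⊆ tightSet M b (fun j => (z j : ℝ)) := by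
  obtain ⟨G, hG, hmin⟩ := exists_minimal_face (isNonemptyFace_tight hx)
  obtain ⟨y, hyG, hy⟩ := h G hmin
  choose z hz using hy
  obtain rfl : y = fun j => (z j : ℝ) := funext hz
  exact ⟨z, hG hyG⟩

end Faces

/-! ### Integer steps leaving a face, from resilience. -/

section Resilience

theorem shiftedPolyhedron_eq (i : Fin m) (s : ℕ) :
    shiftedPolyhedron M b i s = polyhedron M (Function.update b i (b i - s)) := by
  ext x
  constructor
  · rintro ⟨hx, hi⟩ k
    by_cases hk : k = i
    · subst hk
      simpa using hi
    · simpa [hk] using hx k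
  · intro hx
    have hi := hx i
    rw [Function.update_self] at hi
    push_cast at hi
    refine ⟨fun k => ?_, hi⟩
    by_cases hk : k = i
    · subst hk
      exact hi.trans (by simp)
    · simpa [hk] using hx k

/-- Take `y` with a maximal tight set in the truncated face, and an integer `z` on the face of `y`.
Were row `i` larger at `z`, moving from `y` away from `z` would lower it until either a new
constraint became tight, against maximality, or the bound `B` was reached. -/
theorem exists_int_lt_of_bounded_below (hint : IsIntegralPolyhedron (polyhedron M b))
    {J : Finset (Fin m)} {x₁ : Fin n → ℝ} (hx₁ : x₁ ∈ polyhedron M b)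
    (hJ : J ⊆ tightSet M b x₁) (i : Fin m) {B : ℝ}
    (hB : ∀ y ∈ polyhedron M b, J ⊆ tightSet M b y → B < rowForm M i y) :
    ∃ z : Fin n → ℤ, (fun j => (z j : ℝ)) ∈ polyhedron M b ∧
      J ⊆ tightSet M b (fun j => (z j : ℝ)) ∧
      rowForm M i (fun j => (z j : ℝ)) ≤ rowForm M i x₁ := by
  obtain ⟨y, ⟨hy, hJy, hyx⟩, hmax⟩ := exists_maximalFor_of_wellFoundedGT
    (fun y => y ∈ polyhedron M b ∧ J ⊆ tightSet M b y ∧ rowForm M i y ≤ rowForm M i x₁)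
    (tightSet M b) ⟨x₁, hx₁, hJ, le_rfl⟩
  obtain ⟨z, hz, hyz⟩ := hint.exists_int_tight hy
  refine ⟨z, hz, hJy.trans hyz, le_trans ?_ hyx⟩
  by_contra! hlt
  set e : Fin n → ℝ := y - fun j => (z j : ℝ) with he
  have hie : rowForm M i e < 0 := by rw [he, map_sub]; linarith
  have hke : ∀ k ∈ tightSet M b y, rowForm M k e = 0 := fun k hk => by
    rw [he, map_sub, mem_tightSet.1 hk, mem_tightSet.1 (hyz hk), sub_self]
  have hmem : ∀ t : ℝ, ∀ k ∈ tightSet M b y, k ∈ tightSet M b (y + t • e) := fun t k hk => by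
    rw [mem_tightSet, map_add, map_smul, hke k hk, mem_tightSet.1 hk, smul_zero, add_zero]
  by_cases hex : ∃ k ∈ Finset.univ, 0 < rowForm M k e
  · obtain ⟨t, ht, hle, k, -, hkpos, hkt⟩ := exists_max_step Finset.univ
      (fun k => b k - rowForm M k y) (fun k => rowForm M k e)
      (fun k _ => sub_nonneg.2 (hy k)) hex
    have hy' : y + t • e ∈ polyhedron M b := fun k => by
      change rowForm M k _ ≤ _
      rw [map_add, map_smul, smul_eq_mul]
      linarith [hle k (Finset.mem_univ k)]
    have hk' : k ∈ tightSet M b (y + t • e) := by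
      rw [mem_tightSet, map_add, map_smul, smul_eq_mul]
      linarith
    refine hkpos.ne' (hke k (hmax ⟨hy', fun j hj => hmem t j (hJy hj), ?_⟩ (hmem t) hk'))
    rw [map_add, map_smul, smul_eq_mul]
    linarith [mul_nonpos_of_nonneg_of_nonpos ht hie.le]
  · push Not at hex
    have hBy : B < rowForm M i y := hB y hy hJy
    set t := (B - rowForm M i y) / rowForm M i e with ht
    have htpos : 0 ≤ t := div_nonneg_of_nonpos (by linarith) hie.le
    have hy' : y + t • e ∈ polyhedron M b := fun k => by
      change rowForm M k _ ≤ _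
      rw [map_add, map_smul, smul_eq_mul]
      have h₁ : rowForm M k y ≤ b k := hy k
      linarith [mul_nonpos_of_nonneg_of_nonpos htpos (hex k (Finset.mem_univ k))]
    have h := hB _ hy' fun j hj => hmem t j (hJy hj)
    rw [map_add, map_smul, smul_eq_mul, ht, div_mul_cancel₀ _ hie.ne] at h
    linarith

/-- The vector is a difference of integer points: one on the face of `x₀`, one on the larger face of
`x₁` at which row `i` has slack `t`. If the larger face reaches slack `s`, integrality of the
shifted polyhedron gives `t = s`; otherwise slack is below `s` throughout and integrality of the
polyhedron itself gives some `t < s`. -/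
theorem IsOneDivResilient.exists_int_step {p : ℕ} (hres : IsOneDivResilient p M b)
    {x₀ x₁ : Fin n → ℝ} (hx₀ : x₀ ∈ polyhedron M b) (hx₁ : x₁ ∈ polyhedron M b)
    (hsub : tightSet M b x₁ ⊆ tightSet M b x₀) {i : Fin m} (hi₀ : i ∈ tightSet M b x₀)
    (hi₁ : i ∉ tightSet M b x₁) :
    ∃ v : Fin n → ℤ, ∃ t : ℕ, 1 ≤ t ∧ t ≤ p ∧
      (∀ k ∈ tightSet M b x₁, rowForm M k (fun j => (v j : ℝ)) = 0) ∧
      rowForm M i (fun j => (v j : ℝ)) = -t := by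
  obtain ⟨z₀, hz₀, hxz₀⟩ := hres.1.exists_int_tight hx₀
  obtain ⟨s, hs, hsp, hints⟩ := hres.2 i
  suffices ∃ z : Fin n → ℤ, ∃ t : ℕ, 1 ≤ t ∧ t ≤ p ∧
      (∀ k ∈ tightSet M b x₁, rowForm M k (fun j => (z j : ℝ)) = b k) ∧
      rowForm M i (fun j => (z j : ℝ)) = b i - t by
    obtain ⟨z, t, ht, htp, hk, hi⟩ := this
    have hcast : (fun j => (((z - z₀) j : ℤ) : ℝ)) =
        (fun j => (z j : ℝ)) - fun j => (z₀ j : ℝ) := by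
      ext j; simp
    refine ⟨z - z₀, t, ht, htp, fun k hk' => ?_, ?_⟩
    · rw [hcast, map_sub, hk k hk', mem_tightSet.1 (hxz₀ (hsub hk')), sub_self]
    · rw [hcast, map_sub, hi, mem_tightSet.1 (hxz₀ hi₀)]
      ring
  have hs' : (1 : ℝ) ≤ s := by exact_mod_cast hs
  by_cases hex : ∃ y ∈ polyhedron M b, tightSet M b x₁ ⊆ tightSet M b y ∧
      rowForm M i y ≤ b i - s
  · obtain ⟨y, hy, hJy, hiy⟩ := hex
    have hpos : 0 < b i - rowForm M i y := by linarith
    -- Chosen so that row `i` has slack exactly `s` at the point `q` of the segment from `z₀` to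
    -- `y`; the shifted constraint is then tight at `q`.
    set c : ℝ := s / (b i - rowForm M i y) with hc
    have hc₀ : 0 ≤ c := div_nonneg (by linarith) hpos.le
    have hc₁ : c ≤ 1 := (div_le_one hpos).2 (by linarith)
    have hcs : c * (b i - rowForm M i y) = s := div_mul_cancel₀ _ hpos.ne'
    set q : Fin n → ℝ := (1 - c) • (fun j => (z₀ j : ℝ)) + c • y with hq
    have hqmem : q ∈ polyhedron M b :=
      convex_polyhedron hz₀ hy (by linarith) hc₀ (by ring)
    have hqk : ∀ k ∈ tightSet M b x₁, rowForm M k q = b k := fun k hk => by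
      rw [hq, map_add, map_smul, map_smul, mem_tightSet.1 (hxz₀ (hsub hk)),
        mem_tightSet.1 (hJy hk), smul_eq_mul, smul_eq_mul]
      ring
    have hqi : rowForm M i q = b i - s := by
      rw [hq, map_add, map_smul, map_smul, mem_tightSet.1 (hxz₀ hi₀), smul_eq_mul,
        smul_eq_mul]
      linarith
    have hqs : q ∈ shiftedPolyhedron M b i s := ⟨hqmem, hqi.le⟩
    rw [shiftedPolyhedron_eq] at hints hqs
    obtain ⟨z, -, hz⟩ := hints.exists_int_tight hqs
    have hz' : ∀ k, rowForm M k q = (Function.update b i (b i - s) k : ℤ) →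
        rowForm M k (fun j => (z j : ℝ)) = (Function.update b i (b i - s) k : ℤ) :=
      fun k hk => mem_tightSet.1 (hz (mem_tightSet.2 hk))
    refine ⟨z, s, hs, hsp, fun k hk => ?_, ?_⟩
    · have := hz' k
      rw [Function.update_of_ne (ne_of_mem_of_not_mem hk hi₁)] at this
      exact this (hqk k hk)
    · have := hz' i
      rw [Function.update_self, Int.cast_sub, Int.cast_natCast] at this
      exact this hqi
  · push Not at hex
    obtain ⟨z, hz, hJz, hzi⟩ := exists_int_lt_of_bounded_below hres.1 hx₁ subset_rfl i hex
    have hlt : rowForm M i x₁ < b i :=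
      lt_of_le_of_ne (hx₁ i) fun h => hi₁ (mem_tightSet.2 h)
    have hgt := hex _ hz hJz
    have hzi' := hzi.trans_lt hlt
    rw [rowForm_intCast] at hgt hzi'
    have h₁ : (M *ᵥ z) i < b i := by exact_mod_cast hzi'
    have h₂ : b i - s < (M *ᵥ z) i := by exact_mod_cast hgt
    refine ⟨z, (b i - (M *ᵥ z) i).toNat, by omega, by omega,
      fun k hk => mem_tightSet.1 (hJz hk), ?_⟩
    have h₃ : (((b i - (M *ᵥ z) i).toNat : ℤ) : ℝ) = ((b i - (M *ᵥ z) i : ℤ) : ℝ) := by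
      rw [Int.toNat_of_nonneg (by omega)]
    rw [rowForm_intCast, ← Int.cast_natCast, h₃]
    push_cast
    ring

end Resilience

/-! ### Combinations of tight rows with coefficients in a subgroup. -/

section RowLattice

theorem IsFullDimensional.rowForm_eq_zero (hfull : IsFullDimensional (polyhedron M b))
    {i : Fin m} (hi : ∀ x ∈ polyhedron M b, rowForm M i x = b i) : rowForm M i = 0 := by
  have hle : vectorSpan ℝ (polyhedron M b) ≤ LinearMap.ker (rowForm M i) := by
    rw [vectorSpan, Submodule.span_le]
    rintro _ ⟨x, hx, y, hy, rfl⟩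
    change rowForm M i (x - y) = 0
    rw [map_sub, hi x hx, hi y hy, sub_self]
  rw [← direction_affineSpan, show affineSpan ℝ (polyhedron M b) = ⊤ from hfull,
    AffineSubspace.direction_top] at hle
  exact LinearMap.ker_eq_top.1 (top_le_iff.1 hle)

/-- A face that covers the face with the tight constraints of `x₀`. -/
theorem exists_covering_face {x₀ x : Fin n → ℝ} (hx₀ : x₀ ∈ polyhedron M b)
    (hx : x ∈ polyhedron M b) {i₀ : Fin m} (hi₀ : i₀ ∈ tightSet M b x₀)
    (hi₀x : i₀ ∉ tightSet M b x) :
    ∃ x₁ ∈ polyhedron M b, tightSet M b x₁ ⊂ tightSet M b x₀ ∧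
      ∃ i ∈ tightSet M b x₀, i ∉ tightSet M b x₁ ∧
        ∀ e, (∀ k ∈ tightSet M b x₁, rowForm M k e = 0) → rowForm M i e = 0 →
          ∀ k ∈ tightSet M b x₀, rowForm M k e = 0 := by
  obtain ⟨x₁, ⟨hx₁, hss⟩, hmax⟩ := exists_maximalFor_of_wellFoundedGT
    (fun y => y ∈ polyhedron M b ∧ tightSet M b y ⊂ tightSet M b x₀) (tightSet M b)
    ⟨_, midpoint_mem_polyhedron hx₀ hx,
      fun i hi => ((tightSet_midpoint hx₀ hx).1 hi).1,
      fun h => hi₀x ((tightSet_midpoint hx₀ hx).1 (h hi₀)).2⟩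
  obtain ⟨i, hi₀, hi₁⟩ := Finset.exists_of_ssubset hss
  refine ⟨x₁, hx₁, hss, i, hi₀, hi₁, ?_⟩
  have hd : ∀ k, k ∈ tightSet M b x₀ → rowForm M k (x₁ - x₀) ≤ 0 := fun k hk => by
    have : rowForm M k x₁ ≤ b k := hx₁ k
    rw [map_sub, mem_tightSet.1 hk]
    linarith
  have hdJ : ∀ k ∈ tightSet M b x₁, rowForm M k (x₁ - x₀) = 0 := fun k hk => by
    rw [map_sub, mem_tightSet.1 hk, mem_tightSet.1 (hss.1 hk), sub_self]
  have hdi : rowForm M i (x₁ - x₀) ≠ 0 := by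
    rw [map_sub, mem_tightSet.1 hi₀, sub_ne_zero]
    exact fun h => hi₁ (mem_tightSet.2 h)
  -- If `e` were positive on a tight row, the ratio test would tilt `x₁ - x₀` by `e` until a new row
  -- `k'` vanished. Row `i` stays nonzero, so a small step from `x₀` has a tight set still proper in
  -- that of `x₀` and containing that of `x₁`; maximality forces `k'` to be tight at `x₁`, where `e`
  -- vanishes.
  have key : ∀ e, (∀ k ∈ tightSet M b x₁, rowForm M k e = 0) → rowForm M i e = 0 →
      ∀ k ∈ tightSet M b x₀, ¬ 0 < rowForm M k e := by
    intro e he hie k hk hpos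
    obtain ⟨t, -, hle, k', hk', hk'pos, hk't⟩ := exists_max_step (tightSet M b x₀)
      (fun k => - rowForm M k (x₁ - x₀)) (fun k => rowForm M k e)
      (fun k hk => neg_nonneg.2 (hd k hk)) ⟨k, hk, hpos⟩
    have hval : ∀ k, rowForm M k (x₁ - x₀ + t • e) =
        rowForm M k (x₁ - x₀) + t * rowForm M k e := fun k => by
      rw [map_add, map_smul, smul_eq_mul]
    obtain ⟨ε, -, hmem, htight⟩ := exists_pos_step (e := x₁ - x₀ + t • e) hx₀
      fun k hk => by rw [hval]; linarith [hle k hk]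
    have hsub : tightSet M b (x₀ + ε • (x₁ - x₀ + t • e)) ⊂ tightSet M b x₀ := by
      refine ⟨fun k hk => ((htight k).1 hk).1, fun h => hdi ?_⟩
      have := ((htight i).1 (h hi₀)).2
      rwa [hval, hie, mul_zero, add_zero] at this
    have hk₁ : k' ∈ tightSet M b x₁ := by
      refine hmax ⟨hmem, hsub⟩ (fun j hj => (htight j).2 ⟨hss.1 hj, ?_⟩)
        ((htight k').2 ⟨hk', ?_⟩)
      · rw [hval, hdJ j hj, he j hj, mul_zero, add_zero]
      · rw [hval, hk't]
        ring
    exact hk'pos.ne' (he k' hk₁)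
  intro e he hie k hk
  have h₁ := key e he hie k hk
  have h₂ := key (-e) (fun k hk => by rw [map_neg, he k hk, neg_zero])
    (by rw [map_neg, hie, neg_zero]) k hk
  rw [map_neg] at h₂
  linarith

theorem dotProduct_intCast_mem (L : AddSubgroup ℝ) {g : Fin n → ℝ} (hg : ∀ j, g j ∈ L)
    (v : Fin n → ℤ) : (g ⬝ᵥ fun j => (v j : ℝ)) ∈ L := by
  refine L.sum_mem fun j _ => ?_
  rw [mul_comm, ← zsmul_eq_mul]
  exact L.zsmul_mem (hg j) _

/-- A vector with entries in `L` that lies in the span of the rows that are tight on a face is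
a combination of these rows with coefficients in `L`. -/
theorem IsOneDivResilient.exists_row_combination {p : ℕ} (hres : IsOneDivResilient p M b)
    (hfull : IsFullDimensional (polyhedron M b)) (L : AddSubgroup ℝ)
    (hdiv : ∀ t : ℕ, 1 ≤ t → t ≤ p → ∀ x ∈ L, x / t ∈ L) {x₀ : Fin n → ℝ}
    (hx₀ : x₀ ∈ polyhedron M b) {g : Fin n → ℝ} (hg : ∀ j, g j ∈ L)
    (hker : ∀ e, (∀ i ∈ tightSet M b x₀, rowForm M i e = 0) → g ⬝ᵥ e = 0) :
    ∃ z : Fin m → ℝ, (∀ i, z i ∈ L) ∧ (∀ i, i ∉ tightSet M b x₀ → z i = 0) ∧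
      (toReal M)ᵀ *ᵥ z = g := by
  induction hI : tightSet M b x₀ using Finset.strongInduction generalizing x₀ g with
  | H I ih =>
  subst hI
  by_cases hex : ∃ i₀ ∈ tightSet M b x₀, ∃ x ∈ polyhedron M b, i₀ ∉ tightSet M b x
  · obtain ⟨i₀, hi₀, x, hx, hi₀x⟩ := hex
    obtain ⟨x₁, hx₁, hss, i, hi, hi₁, hcov⟩ := exists_covering_face hx₀ hx hi₀ hi₀x
    obtain ⟨v, t, ht, htp, hv, hvi⟩ := hres.exists_int_step hx₀ hx₁ hss.1 hi hi₁
    have ht₀ : (t : ℝ) ≠ 0 := by positivity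
    -- Pairing with `v` kills the rows tight at `x₁` and sends row `i` to `-t`, so row `i` must
    -- occur in `g` with coefficient `-r`.
    set r : ℝ := (g ⬝ᵥ fun j => (v j : ℝ)) / t with hr
    have hrL : r ∈ L := hdiv t ht htp _ (dotProduct_intCast_mem L hg v)
    have hrow : ∀ e, (r • toReal M i) ⬝ᵥ e = r * rowForm M i e := fun e => by
      rw [smul_dotProduct, smul_eq_mul]
      rfl
    obtain ⟨z, hzL, hz₀, hz⟩ := ih _ hss (x₀ := x₁) (g := g + r • toReal M i) hx₁
      (fun j => by
        refine L.add_mem (hg j) ?_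
        change r * ((M i j : ℤ) : ℝ) ∈ L
        rw [mul_comm, ← zsmul_eq_mul]
        exact L.zsmul_mem hrL _)
      (fun e he => by
        -- The multiple of `v` corrects `e` so that row `i` also vanishes; the covering property
        -- then makes all rows tight at `x₀` vanish.
        have h := hker (e + (rowForm M i e / t) • fun j => (v j : ℝ)) <|
          hcov _ (fun k hk => by rw [map_add, map_smul, he k hk, hv k hk]; simp) (by
            rw [map_add, map_smul, hvi, smul_eq_mul]
            field_simp
            ring)
        rw [dotProduct_add, dotProduct_smul, smul_eq_mul] at h
        rw [add_dotProduct, hrow, ← h, hr]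
        ring) rfl
    refine ⟨z - Pi.single i r, fun k => ?_, fun k hk => ?_, ?_⟩
    · refine L.sub_mem (hzL k) ?_
      by_cases hk : k = i
      · subst hk; simpa using hrL
      · simp [hk]
    · have hki : k ≠ i := fun h => hk (h ▸ hi)
      simp [hki, hz₀ k fun h => hk (hss.1 h)]
    · rw [Matrix.mulVec_sub, hz]
      ext j
      simp [Matrix.mulVec_single, mul_comm]
  · push Not at hex
    have hg₀ : g = 0 := by
      refine dotProduct_eq_zero g fun e => hker e fun i hi => ?_
      rw [hfull.rowForm_eq_zero fun x hx => mem_tightSet.1 (hex i hi x hx),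
        LinearMap.zero_apply]
    exact ⟨0, fun _ => L.zero_mem, fun _ _ => rfl, by rw [hg₀, Matrix.mulVec_zero]⟩

end RowLattice

/-! ### Complementary slackness and strict complementarity. -/

section Complementarity

theorem isDualOptimal_of_tight {w x₀ : Fin n → ℝ} {y : Fin m → ℝ}
    (hx₀ : x₀ ∈ polyhedron M b) (hy : (toReal M)ᵀ *ᵥ y = w) (hy₀ : ∀ i, 0 ≤ y i)
    (hsupp : ∀ i, i ∉ tightSet M b x₀ → y i = 0) : IsDualOptimal M b w y := by
  refine ⟨⟨hy, hy₀⟩, fun y' hy' => ?_⟩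
  calc (fun i => (b i : ℝ)) ⬝ᵥ y = ∑ i, y i * rowForm M i x₀ :=
        Finset.sum_congr rfl fun i _ => by
          by_cases hi : i ∈ tightSet M b x₀
          · rw [mem_tightSet.1 hi, mul_comm]
          · rw [hsupp i hi, mul_zero, zero_mul]
    _ = w ⬝ᵥ x₀ := by rw [← dotProduct_transpose_mulVec, hy]
    _ = ∑ i, y' i * rowForm M i x₀ := by rw [← dotProduct_transpose_mulVec, hy'.1]
    _ ≤ ∑ i, b i * y' i := Finset.sum_le_sum fun i _ => by
          rw [mul_comm]
          exact mul_le_mul_of_nonneg_right (hx₀ i) (hy'.2 i)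

/-- Strict complementarity for the dual pair of linear programs. -/
theorem IsAdmissible.exists_strictly_complementary {w : Fin n → ℝ}
    (hw : IsAdmissible M b w) :
    ∃ x₀ ∈ polyhedron M b, ∃ y : Fin m → ℝ, (toReal M)ᵀ *ᵥ y = w ∧
      (∀ i ∈ tightSet M b x₀, 0 < y i) ∧ ∀ i, i ∉ tightSet M b x₀ → y i = 0 := by
  classical
  obtain ⟨x₀, hx₀, hmin⟩ :=
    exists_minimalFor_of_wellFoundedLT (IsPrimalOptimal M b w) (tightSet M b) hw
  set I := tightSet M b x₀ with hI
  let f : (Fin n → ℝ) →ₗ[ℝ] ℝ := dotProductBilin ℝ ℝ w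
  have hf : ∀ e, f e = w ⬝ᵥ e := fun _ => rfl
  have hle : ∀ e, (∀ i ∈ I, rowForm M i e ≤ 0) → f e ≤ 0 := fun e he => by
    obtain ⟨ε, hε, hmem, -⟩ := exists_pos_step hx₀.1 he
    have h := hx₀.2 _ hmem
    rw [dotProduct_add, dotProduct_smul, smul_eq_mul] at h
    rw [hf]
    nlinarith
  have hzero : ∀ e, (∀ i ∈ I, rowForm M i e ≤ 0) → 0 ≤ f e →
      ∀ i ∈ I, rowForm M i e = 0 := fun e he hfe i hi => by
    obtain ⟨ε, hε, hmem, htight⟩ := exists_pos_step hx₀.1 he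
    have hopt : IsPrimalOptimal M b w (x₀ + ε • e) := by
      refine ⟨hmem, fun x' hx' => (hx₀.2 x' hx').trans ?_⟩
      rw [dotProduct_add, dotProduct_smul, smul_eq_mul]
      rw [hf] at hfe
      linarith [mul_nonneg hε.le hfe]
    exact ((htight i).1 (hmin hopt (fun k hk => ((htight k).1 hk).1) hi)).2
  obtain ⟨c₀, hc₀, hfc₀⟩ := exists_nonneg_combination I (rowForm M) f hle
  -- Farkas with the extra inequality `-f ≤ 0` (index `none`) writes `c none • f` as a combination
  -- of the tight rows with coefficients at least `1`. Adding `f` itself, written with `c₀`, makes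
  -- the factor `1 + c none` invertible.
  obtain ⟨c, hc, hfc⟩ := exists_nonneg_combination (Finset.insertNone I)
    (fun o => o.elim (-f) (rowForm M)) (-∑ i ∈ I, rowForm M i) fun e he => by
      have hz := hzero e (fun i hi => he (some i) (by simpa using hi))
        (by simpa using he none (by simp))
      rw [LinearMap.neg_apply, LinearMap.sum_apply, Finset.sum_eq_zero hz, neg_zero]
  have hpos : 0 < 1 + c none := by linarith [hc none]
  refine ⟨x₀, hx₀.1, fun i => if i ∈ I then (c₀ i + 1 + c (some i)) / (1 + c none) else 0,
    dotProduct_eq _ _ fun e => ?_, fun i hi => ?_, fun i hi => if_neg hi⟩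
  · rw [dotProduct_transpose_mulVec, ← hf]
    have h₁ := hfc₀ e
    have h₂ := hfc e
    simp only [Finset.sum_insertNone, Option.elim, LinearMap.neg_apply,
      LinearMap.sum_apply] at h₂
    simp only [ite_mul, zero_mul, Finset.sum_ite_mem, Finset.univ_inter]
    have h₃ : ∑ i ∈ I, (c₀ i + 1 + c (some i)) / (1 + c none) * rowForm M i e =
        (∑ i ∈ I, c₀ i * rowForm M i e + ∑ i ∈ I, rowForm M i e +
          ∑ i ∈ I, c (some i) * rowForm M i e) / (1 + c none) := by
      rw [← Finset.sum_add_distrib, ← Finset.sum_add_distrib, Finset.sum_div]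
      exact Finset.sum_congr rfl fun i _ => by ring
    rw [h₃, div_eq_iff hpos.ne']
    linarith
  · simp only [if_pos (hI ▸ hi : i ∈ I)]
    exact div_pos (by linarith [hc₀ i, hc (some i)]) hpos

end Complementarity

/-! ### Density of subgroup points in rational subspaces. -/

section Density

variable {κ : Type*} [Fintype κ]

/-- The solution space of finitely many homogeneous linear equations with integer coefficients
is spanned by its integer points. -/
theorem mem_span_int_of_dotProduct_eq_zero (s : Finset (κ → ℤ)) {u : κ → ℝ}
    (hu : ∀ c ∈ s, (fun k => (c k : ℝ)) ⬝ᵥ u = 0) :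
    u ∈ Submodule.span ℝ
      ((fun (v : κ → ℤ) (k : κ) => (v k : ℝ)) '' {v | ∀ c ∈ s, c ⬝ᵥ v = 0}) := by
  classical
  induction s using Finset.induction_on generalizing u with
  | empty =>
    rw [pi_eq_sum_univ' u]
    refine Submodule.sum_mem _ fun k _ => Submodule.smul_mem _ _
      (Submodule.subset_span ⟨Pi.single k 1, by simp, ?_⟩)
    ext l
    by_cases h : k = l
    · subst h; simp
    · simp [Ne.symm h]
  | insert d s hd ih =>
    have hus := ih fun c hc => hu c (Finset.mem_insert_of_mem hc)
    have hdu := hu d (Finset.mem_insert_self d s)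
    have hcast : ∀ v : κ → ℤ, (fun k => (d k : ℝ)) ⬝ᵥ (fun k => (v k : ℝ)) =
        ((d ⬝ᵥ v : ℤ) : ℝ) := fun v => by simp [dotProduct]
    by_cases hex : ∃ v : κ → ℤ, (∀ c ∈ s, c ⬝ᵥ v = 0) ∧ d ⬝ᵥ v ≠ 0
    · obtain ⟨v, hv, hdv⟩ := hex
      have hdv' : ((d ⬝ᵥ v : ℤ) : ℝ) ≠ 0 := by exact_mod_cast hdv
      -- A denominator-free projection along `v` into the kernel of `d`: it preserves integrality
      -- and acts on `u` as the nonzero scalar `d ⬝ᵥ v`.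
      let T : (κ → ℝ) →ₗ[ℝ] (κ → ℝ) := ((d ⬝ᵥ v : ℤ) : ℝ) • LinearMap.id -
        (dotProductBilin ℝ ℝ fun k => (d k : ℝ)).smulRight fun k => (v k : ℝ)
      have hT : ∀ x, T x = ((d ⬝ᵥ v : ℤ) : ℝ) • x -
        ((fun k => (d k : ℝ)) ⬝ᵥ x) • fun k => (v k : ℝ) := fun x => rfl
      have hTu := Submodule.mem_map_of_mem (f := T) hus
      rw [Submodule.map_span, hT, hdu, zero_smul, sub_zero] at hTu
      rw [← inv_smul_smul₀ hdv' u]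
      refine Submodule.smul_mem _ _ (Submodule.span_mono ?_ hTu)
      rintro _ ⟨_, ⟨x, hx, rfl⟩, rfl⟩
      refine ⟨(d ⬝ᵥ v) • x - (d ⬝ᵥ x) • v, fun c hc => ?_, ?_⟩
      · rw [dotProduct_sub, dotProduct_smul, dotProduct_smul, smul_eq_mul, smul_eq_mul]
        rcases Finset.mem_insert.1 hc with rfl | hc
        · ring
        · rw [hx c hc, hv c hc, mul_zero, mul_zero, sub_zero]
      · rw [hT, hcast]
        ext k
        simp
    · push Not at hex
      refine Submodule.span_mono (Set.image_mono fun v hv c hc => ?_) hus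
      rcases Finset.mem_insert.1 hc with rfl | hc
      · exact hex v hv
      · exact hv c hc

/-- Write `u` as a real combination of integer solutions and approximate each scalar by elements of
`L`. -/
theorem mem_closure_of_dotProduct_eq_zero {L : AddSubgroup ℝ} (hL : Dense (L : Set ℝ))
    (s : Finset (κ → ℤ)) {u : κ → ℝ} (hu : ∀ c ∈ s, (fun k => (c k : ℝ)) ⬝ᵥ u = 0) :
    u ∈ closure {x : κ → ℝ | (∀ k, x k ∈ L) ∧ ∀ c ∈ s, (fun k => (c k : ℝ)) ⬝ᵥ x = 0} := by
  let H : AddSubgroup (κ → ℝ) :=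
    { carrier := {x | (∀ k, x k ∈ L) ∧ ∀ c ∈ s, (fun k => (c k : ℝ)) ⬝ᵥ x = 0}
      zero_mem' := ⟨fun _ => L.zero_mem, fun _ _ => dotProduct_zero _⟩
      add_mem' := fun hx hy => ⟨fun k => L.add_mem (hx.1 k) (hy.1 k), fun c hc => by
        rw [dotProduct_add, hx.2 c hc, hy.2 c hc, add_zero]⟩
      neg_mem' := fun hx => ⟨fun k => L.neg_mem (hx.1 k), fun c hc => by
        rw [dotProduct_neg, hx.2 c hc, neg_zero]⟩ }
  change u ∈ H.topologicalClosure
  have hspan := mem_span_int_of_dotProduct_eq_zero s hu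
  clear hu
  induction hspan using Submodule.closure_induction with
  | zero => exact AddSubgroup.zero_mem _
  | add x y _ _ hx hy => exact AddSubgroup.add_mem _ hx hy
  | smul_mem r x hx =>
    obtain ⟨v, hv, rfl⟩ := hx
    have hcont : Continuous fun r : ℝ => r • fun k => (v k : ℝ) := by fun_prop
    have hmem := image_closure_subset_closure_image hcont ⟨r, hL r, rfl⟩
    refine closure_mono ?_ hmem
    rintro _ ⟨l, hl, rfl⟩
    refine ⟨fun k => ?_, fun c hc => ?_⟩
    · change l * (v k : ℝ) ∈ L
      rw [mul_comm, ← zsmul_eq_mul]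
      exact L.zsmul_mem hl _
    · have : (fun k => (c k : ℝ)) ⬝ᵥ (fun k => (v k : ℝ)) = ((c ⬝ᵥ v : ℤ) : ℝ) := by
        simp [dotProduct]
      rw [dotProduct_smul, this, hv c hc, Int.cast_zero, smul_zero]

end Density

/-! ### Moving the strictly complementary dual solution into the subgroup. -/

theorem IsOneDivResilient.isTotallyDualIn {p : ℕ} (hres : IsOneDivResilient p M b)
    (hfull : IsFullDimensional (polyhedron M b)) {L : AddSubgroup ℝ}
    (hL : Dense (L : Set ℝ)) (hdiv : ∀ t : ℕ, 1 ≤ t → t ≤ p → ∀ x ∈ L, x / t ∈ L) :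
    IsTotallyDualIn (L : Set ℝ) M b := by
  classical
  intro w hwL hw
  obtain ⟨x₀, hx₀, y, hy, hypos, hy₀⟩ := hw.exists_strictly_complementary
  obtain ⟨z, hzL, hz₀, hz⟩ := hres.exists_row_combination hfull L hdiv hx₀ hwL fun e he => by
    rw [← hy, dotProduct_transpose_mulVec]
    refine Finset.sum_eq_zero fun i _ => ?_
    by_cases hi : i ∈ tightSet M b x₀
    · rw [he i hi, mul_zero]
    · rw [hy₀ i hi, zero_mul]
  -- Integer equations for `Mᵀu = 0` together with vanishing off the tight set.
  let s : Finset (Fin m → ℤ) := Finset.univ.image (fun j i => M i j) ∪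
    (tightSet M b x₀)ᶜ.image fun i => Pi.single i 1
  have hs : ∀ u : Fin m → ℝ, (∀ c ∈ s, (fun k => (c k : ℝ)) ⬝ᵥ u = 0) ↔
      (toReal M)ᵀ *ᵥ u = 0 ∧ ∀ i, i ∉ tightSet M b x₀ → u i = 0 := by
    intro u
    have hsingle : ∀ i, (fun k => ((Pi.single i 1 : Fin m → ℤ) k : ℝ)) ⬝ᵥ u = u i := by
      intro i
      simp [dotProduct, Pi.single_apply]
    simp only [s, Finset.mem_union, Finset.mem_image, Finset.mem_univ, true_and,
      Finset.mem_compl, or_imp, forall_and, forall_exists_index, and_imp,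
      forall_apply_eq_imp_iff, forall_apply_eq_imp_iff₂, hsingle]
    exact and_congr_left fun _ => ⟨fun h => funext h, fun h j => congrFun h j⟩
  have hmem := mem_closure_of_dotProduct_eq_zero hL s ((hs (y - z)).2
    ⟨by rw [Matrix.mulVec_sub, hy, hz, sub_self], fun i hi => by simp [hy₀ i hi, hz₀ i hi]⟩)
  have hopen : IsOpen {u : Fin m → ℝ | ∀ i ∈ tightSet M b x₀, 0 < z i + u i} := by
    simp only [Set.ofPred_forall]
    exact isOpen_biInter_finset fun i _ => isOpen_lt (by fun_prop) (by fun_prop)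
  obtain ⟨u, hupos, huL, hu⟩ := mem_closure_iff.1 hmem _ hopen fun i hi => by
    simpa using hypos i hi
  obtain ⟨hu, hu₀⟩ := (hs u).1 hu
  refine ⟨z + u, isDualOptimal_of_tight hx₀ (by rw [Matrix.mulVec_add, hz, hu, add_zero])
    (fun i => ?_) fun i hi => by simp [hz₀ i hi, hu₀ i hi],
    fun i => L.add_mem (hzL i) (huL i)⟩
  by_cases hi : i ∈ tightSet M b x₀
  · exact (hupos i hi).le
  · simp [hz₀ i hi, hu₀ i hi]

/-! ### Rationals with bounded prime denominators as a dense subgroup. -/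

section RationalsUpTo

theorem pos_of_mem_closure_primes {p s : ℕ}
    (hs : s ∈ Submonoid.closure {q : ℕ | q.Prime ∧ q ≤ p}) : 0 < s := by
  induction hs using Submonoid.closure_induction with
  | mem q hq => exact hq.1.pos
  | one => exact one_pos
  | mul x y _ _ hx hy => exact Nat.mul_pos hx hy

theorem mem_closure_primes_of_le {p t : ℕ} (ht : 1 ≤ t) (htp : t ≤ p) :
    t ∈ Submonoid.closure {q : ℕ | q.Prime ∧ q ≤ p} := by
  rw [← Nat.prod_primeFactorsList (n := t) (by omega)]
  exact Submonoid.list_prod_mem _ fun q hq => Submonoid.subset_closure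
    ⟨Nat.prime_of_mem_primeFactorsList hq, (Nat.le_of_mem_primeFactorsList hq).trans htp⟩

/-- The rationals whose denominators are products of primes up to `p`, as a subgroup of `ℝ`. -/
def rationalsUpToSubgroup (p : ℕ) : AddSubgroup ℝ where
  carrier := rationalsUpTo p
  zero_mem' := ⟨0, 1, Submonoid.one_mem _, by simp⟩
  add_mem' := by
    rintro _ _ ⟨r, s, hs, rfl⟩ ⟨r', s', hs', rfl⟩
    have h : (s : ℝ) ≠ 0 := by exact_mod_cast (pos_of_mem_closure_primes hs).ne'
    have h' : (s' : ℝ) ≠ 0 := by exact_mod_cast (pos_of_mem_closure_primes hs').ne'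
    refine ⟨r * s' + s * r', s * s', Submonoid.mul_mem _ hs hs', ?_⟩
    push_cast
    exact div_add_div _ _ h h'
  neg_mem' := by
    rintro _ ⟨r, s, hs, rfl⟩
    exact ⟨-r, s, hs, by push_cast; ring⟩

theorem div_mem_rationalsUpToSubgroup {p t : ℕ} (ht : 1 ≤ t) (htp : t ≤ p) {x : ℝ}
    (hx : x ∈ rationalsUpToSubgroup p) : x / t ∈ rationalsUpToSubgroup p := by
  obtain ⟨r, s, hs, rfl⟩ := hx
  refine ⟨r, s * t, Submonoid.mul_mem _ hs (mem_closure_primes_of_le ht htp), ?_⟩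
  push_cast
  exact div_div _ _ _

theorem dense_rationalsUpToSubgroup {p : ℕ} (hp : 2 ≤ p) :
    Dense (rationalsUpToSubgroup p : Set ℝ) := by
  refine AddSubgroup.dense_of_not_isolated_zero _ fun ε hε => ?_
  obtain ⟨k, hk⟩ := exists_pow_lt_of_lt_one hε (by norm_num : (1 / 2 : ℝ) < 1)
  refine ⟨(1 / 2) ^ k, ⟨1, 2 ^ k, Submonoid.pow_mem _
    (mem_closure_primes_of_le one_le_two hp) k, by simp⟩, by positivity, hk⟩

theorem rationalsUpTo_two : rationalsUpTo 2 = rationalsOver {2} := by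
  have : {q : ℕ | q.Prime ∧ q ≤ 2} = {2} := by
    ext q
    exact ⟨fun h => le_antisymm h.2 h.1.two_le, fun h => by
      rw [Set.mem_singleton_iff] at h
      subst h
      exact ⟨Nat.prime_two, le_rfl⟩⟩
  rw [rationalsUpTo, this]

end RationalsUpTo

/-! ### Specialisation to the three resilience notions. -/

theorem IsResilient.isOneDivResilient (h : IsResilient M b) : IsOneDivResilient 1 M b :=
  ⟨h.1, fun i => ⟨1, le_rfl, le_rfl, h.2 i⟩⟩

theorem IsHalfResilient.isOneDivResilient (h : IsHalfResilient M b) :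
    IsOneDivResilient 2 M b :=
  ⟨h.1, fun i => (h.2 i).elim (fun hi => ⟨1, le_rfl, one_le_two, hi⟩)
    fun hi => ⟨2, one_le_two, le_rfl, hi⟩⟩

end TotalDuality

theorem mainTheorem3 {m n : ℕ} (M : Matrix (Fin m) (Fin n) ℤ) (b : Fin m → ℤ)
    (hfull : TotalDuality.IsFullDimensional (TotalDuality.polyhedron M b)) :
    (TotalDuality.IsResilient M b →
      ∀ L : Set ℝ, TotalDuality.IsHeavy L → TotalDuality.IsTotallyDualIn L M b) ∧
    (TotalDuality.IsHalfResilient M b → TotalDuality.IsTotallyDualDyadic M b) ∧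
    (∀ p : ℕ, 2 ≤ p → TotalDuality.IsOneDivResilient p M b →
      TotalDuality.IsTotallyDualIn (TotalDuality.rationalsUpTo p) M b) := by
  have hc : ∀ p : ℕ, 2 ≤ p → TotalDuality.IsOneDivResilient p M b →
      TotalDuality.IsTotallyDualIn (TotalDuality.rationalsUpTo p) M b := fun p hp hres =>
    hres.isTotallyDualIn hfull (TotalDuality.dense_rationalsUpToSubgroup hp)
      fun _ ht htp _ hx => TotalDuality.div_mem_rationalsUpToSubgroup ht htp hx
  refine ⟨fun hres L hL => ?_, fun hres => ?_, hc⟩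
  · obtain ⟨H, rfl⟩ := hL.isAddSubgroup
    refine hres.isOneDivResilient.isTotallyDualIn hfull hL.dense fun t ht htp x hx => ?_
    obtain rfl : t = 1 := le_antisymm htp ht
    simpa using hx
  · rw [TotalDuality.IsTotallyDualDyadic, ← TotalDuality.rationalsUpTo_two]
    exact hc 2 le_rfl hres.isOneDivResilient
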